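/- **Setting.** An arm with $n$ states is a Markov decision process with state space $[n]=\{1,\dots,n\}$, actions $a\in\{0,1\}$ ($0$ = rest, $1$ = activate), rewards $r^a_i\in\mathbb R$ and stochastic transition matrices $P^a$. A policy is a set $\pi\subseteq[n]$ of active states; write $\pi_i=1$ if $i\in\pi$ and $\pi_i=0$ otherwise, and $P^\pi_{ij}=P^{\pi_i}_{ij}$. A policy is unichain if $P^\pi$ has exactly one recurrent class, and multichain otherwise; the arm is unichain if every policy is unichain. For $\lambda\in\mathbb R$, the $\lambda$-penalized arm has rewards $r^a_i-\lambda a$. Its optimal gain $g^*(\lambda)$ is the maximum over all policies of the long-term average expected reward (for a unichain arm it does not depend on the initial state). A policy $\pi$ is Bellman optimal for $\lambda$ if there is $h\in\mathbb R^n$ such that, for all $i$, $$g^*(\lambda)+h_i=\max_{a\in\{0,1\}}\Big(r^a_i-\lambda a+\sum_j P^a_{ij}h_j\Big)$$ and $a=\pi_i$ attains this maximum. The arm is indexable if for all $\lambda<\lambda'$, every policy $\pi$ that is Bellman optimal for $\lambda$ and every policy $\pi'$ that is Bellman optimal for $\lambda'$ satisfy $\pi\supseteq\pi'$. For a unichain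 policy $\pi$, the active advantage is $\alpha^\pi_i(\lambda)=r^1_i-r^0_i-\lambda+\sum_j(P^1_{ij}-P^0_{ij})h_j$, where $h$ is any solution, for some $g\in\mathbb R$, of $g+h_i=r^{\pi_i}_i-\lambda\pi_i+\sum_jP^{\pi_i}_{ij}h_j$ for all $i$ ($h$ exists and is unique up to an additive constant); $\alpha^\pi_i(+\infty)$ denotes the limit in $[-\infty,+\infty]$ of the affine function $\alpha_i^\pi$ at $+\infty$. **Algorithm 1.** Set $\pi^1=[n]$ and $\mu^0=-\infty$. If $\pi^1$ is multichain, return "the arm is multichain". For $k=1,\dots,n$: 1. let $\mu^k=\inf\{\lambda\in\mathbb R:\lambda\ge\mu^{k-1},\ \exists i\in\pi^k,\ \alpha^{\pi^k}_i(\lambda)=0\}$ (with $\inf\emptyset=+\infty$); 2. if $\mu^{k-1}<\mu^k$ and $\alpha^{\pi^k}_i(\mu^k)\ge0$ for some $i\notin\pi^k$, return "the arm is not indexable"; 3. if $\mu^k=+\infty$, set $\lambda_i=+\infty$ for all $i\in\pi^k$ and return "the arm is indexable and the indices are $(\lambda_i)_{i\in[n]}$"; 4. choose any $\sigma^k\in\pi^k$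 with $\alpha^{\pi^k}_{\sigma^k}(\mu^k)=0$, set $\lambda_{\sigma^k}=\mu^k$ and $\pi^{k+1}=\pi^k\setminus\{\sigma^k\}$; if $\pi^{k+1}$ is multichain, return "the arm is multichain". After the loop, return "the arm is indexable and the indices are $(\lambda_i)_{i\in[n]}$". **Corollary 1.** Given a unichain arm with finitely many states, and whatever choices of the $\sigma^k$ are made, Algorithm 1 outputs "the arm is indexable" (with some indices) if and only if the arm is indexable; and it never outputs "the arm is multichain". -/

import Mathlib

/-- A restless bandit arm: a Markov decision process with state space `Fin n` and actions
`0` (rest) and `1` (activate). `r a i` is the reward and `P a i j` the probability of moving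
from `i` to `j` when action `a` is taken in state `i`. -/
structure Arm (n : ℕ) where
  r : Fin 2 → Fin n → ℝ
  P : Fin 2 → Matrix (Fin n) (Fin n) ℝ
  P_nonneg : ∀ a i j, 0 ≤ P a i j
  P_sum : ∀ a i, ∑ j, P a i j = 1

/-- State `j` is accessible from state `i` in the Markov chain with transition matrix `M`. -/
def Accessible {n : ℕ} (M : Matrix (Fin n) (Fin n) ℝ) (i j : Fin n) : Prop :=
  ∃ t : ℕ, 0 < (M ^ t) i j

/-- A recurrent class of a finite Markov chain: a nonempty set of states that is closed and all
of whose states communicate, i.e. that is the set of states accessible from any of its members. -/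
def IsRecurrentClass {n : ℕ} (M : Matrix (Fin n) (Fin n) ℝ) (C : Set (Fin n)) : Prop :=
  C.Nonempty ∧ ∀ i ∈ C, ∀ j, j ∈ C ↔ Accessible M i j

namespace Arm

variable {n : ℕ}

/-- The action chosen in state `i` by the policy whose set of active states is `π`. -/
def act (π : Finset (Fin n)) (i : Fin n) : Fin 2 := if i ∈ π then 1 else 0

/-- The reward of action `a` in state `i` in the `lam`-penalized arm. -/
def reward (A : Arm n) (lam : ℝ) (a : Fin 2) (i : Fin n) : ℝ :=
  A.r a i - lam * ((a : ℕ) : ℝ)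

/-- The transition matrix of the Markov chain induced by the policy `π`. -/
def trans (A : Arm n) (π : Finset (Fin n)) : Matrix (Fin n) (Fin n) ℝ :=
  fun i j => A.P (act π i) i j

/-- The policy `π` is unichain. A policy that is not unichain is multichain. -/
def UnichainPolicy (A : Arm n) (π : Finset (Fin n)) : Prop :=
  ∃! C : Set (Fin n), IsRecurrentClass (A.trans π) C

/-- The arm is unichain. -/
def Unichain (A : Arm n) : Prop := ∀ π : Finset (Fin n), A.UnichainPolicy π

/-- In the `lam`-penalized arm, `x` is the gain (long-term average expected reward) of the
policy `π` from the initial state `i`. -/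
def HasGain (A : Arm n) (lam : ℝ) (π : Finset (Fin n)) (i : Fin n) (x : ℝ) : Prop :=
  Filter.Tendsto
    (fun T : ℕ => (∑ t ∈ Finset.range T,
      ((A.trans π ^ t).mulVec fun j => A.reward lam (act π j) j) i) / (T : ℝ))
    Filter.atTop (nhds x)

/-- `g` is the maximal gain over all policies, from every initial state. -/
def IsOptimalGain (A : Arm n) (lam g : ℝ) : Prop :=
  ∀ i, IsGreatest {x | ∃ π : Finset (Fin n), A.HasGain lam π i x} g

/-- The right-hand side of the Bellman equation for action `a` in state `i`. -/
def actionValue (A : Arm n) (lam : ℝ) (h : Fin n → ℝ) (a : Fin 2) (i : Fin n) : ℝ :=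
  A.reward lam a i + ∑ j, A.P a i j * h j

/-- The policy `π` is Bellman optimal for the penalty `lam`: with `g` the optimal gain, some
solution `h` of the Bellman optimality equation is such that `π` attains all the maxima. -/
def BellmanOptimal (A : Arm n) (lam : ℝ) (π : Finset (Fin n)) : Prop :=
  ∃ (g : ℝ) (h : Fin n → ℝ), A.IsOptimalGain lam g ∧
    (∀ i, g + h i = max (A.actionValue lam h 0 i) (A.actionValue lam h 1 i)) ∧
    ∀ i, A.actionValue lam h (act π i) i
      = max (A.actionValue lam h 0 i) (A.actionValue lam h 1 i)

/-- The arm is indexable. -/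
def Indexable (A : Arm n) : Prop :=
  ∀ lam lam' : ℝ, lam < lam' → ∀ π π' : Finset (Fin n),
    A.BellmanOptimal lam π → A.BellmanOptimal lam' π' → π' ⊆ π

/-- `h` is a bias vector of the policy `π` for the penalty `lam`. -/
def IsBias (A : Arm n) (lam : ℝ) (π : Finset (Fin n)) (h : Fin n → ℝ) : Prop :=
  ∃ g : ℝ, ∀ i, g + h i = A.actionValue lam h (act π i) i

/-- A bias vector of the policy `π`. For a unichain policy there is one, and it is unique up to
an additive constant. -/
noncomputable def bias (A : Arm n) (π : Finset (Fin n)) (lam : ℝ) : Fin n → ℝ :=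
  Classical.epsilon fun h => A.IsBias lam π h

/-- The active advantage of state `i` under the policy `π` for the penalty `lam`. For a unichain
policy it does not depend on the choice of the bias vector. -/
noncomputable def adv (A : Arm n) (π : Finset (Fin n)) (i : Fin n) (lam : ℝ) : ℝ :=
  A.r 1 i - A.r 0 i - lam + ∑ j, (A.P 1 i j - A.P 0 i j) * A.bias π lam j

/-- The active advantage as a function of an extended penalty: at `±∞` it is the limit, which
exists in `[-∞, +∞]` for a unichain policy since the active advantage is then affine. -/
noncomputable def advE (A : Arm n) (π : Finset (Fin n)) (i : Fin n) : EReal → EReal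
  | ⊤ => Filter.limUnder Filter.atTop fun lam : ℝ => (A.adv π i lam : EReal)
  | ⊥ => Filter.limUnder Filter.atBot fun lam : ℝ => (A.adv π i lam : EReal)
  | (lam : ℝ) => (A.adv π i lam : EReal)

/-- The smallest penalty at or above `μ` at which the active advantage of some active state
vanishes (`+∞` if there is none). -/
noncomputable def nextPenalty (A : Arm n) (π : Finset (Fin n)) (μ : EReal) : EReal :=
  sInf {x : EReal | ∃ lam : ℝ, x = lam ∧ μ ≤ lam ∧ ∃ i ∈ π, A.adv π i lam = 0}

/-- The possible outputs of the algorithm. -/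
inductive Output (n : ℕ) where
  | multichain : Output n
  | notIndexable : Output n
  | indexable (index : Fin n → EReal) : Output n

open Classical in
/-- The main loop. The arguments are the number of iterations left, and, at the start of
iteration `k`, the policy `π^k`, the penalty `μ^{k-1}` and the indices assigned so far.
The function `choice` resolves the choice of the state that is removed from the policy among
the active states whose active advantage vanishes at `μ^k`. -/
noncomputable def loop (A : Arm n) (choice : Finset (Fin n) → Fin n) :
    ℕ → Finset (Fin n) → EReal → (Fin n → EReal) → Output n
  | 0, _, _, index => .indexable index
  | m + 1, π, μ, index =>
    let μ' := A.nextPenalty π μ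
    if μ < μ' ∧ ∃ i, i ∉ π ∧ 0 ≤ A.advE π i μ' then .notIndexable
    else if μ' = ⊤ then .indexable fun i => if i ∈ π then ⊤ else index i
    else
      let σ := choice (π.filter fun i => A.advE π i μ' = 0)
      let π' := π.erase σ
      if ¬ A.UnichainPolicy π' then .multichain
      else loop A choice m π' μ' (Function.update index σ μ')

open Classical in
/-- The algorithm. The initial value of the indices is a placeholder. -/
noncomputable def algorithm (A : Arm n) (choice : Finset (Fin n) → Fin n) : Output n :=
  if ¬ A.UnichainPolicy Finset.univ then .multichain
  else loop A choice n Finset.univ ⊥ fun _ => ⊥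

end Arm

/-! The engine is a comparison principle (`Unichain.eq_zero_and_const`). Suppose that in every state
`δ + d i` is at most the average of `d` under one action and at least its average under another. The
extremes of `d` give `δ = 0`. Suitable actions then make both the maximisers and the minimisers of
`d` closed, and a unichain arm has no two disjoint closed sets, so `d` is constant.

Applied to a difference of bias vectors, this gives `Unichain.adv_eq_adv`: policies whose advantages
have opposite signs wherever they differ have equal advantages everywhere. Hence greedy policies
exist, they are the Bellman optimal ones, and they share their advantages, called `optAdv`. Flipping
a state of zero advantage changes no advantage. Indexability becomes a single-crossing property of
`optAdv`.

The algorithm follows `optAdv` as the penalty grows. Until the next penalty the active advantages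
keep their sign, and the passive ones, being affine, are controlled by the test at the endpoint
alone. A triggered test contradicts single crossing (`LoopInvariant.not_indexable`). Otherwise the
policy stays greedy and loses one state, and once it is empty every state has crossed exactly once.
-/

section Stochastic

variable {n : ℕ}

/-! ### Closed sets and recurrent classes of a finite Markov chain -/

/-- A set of states that the Markov chain with transition matrix `M` never leaves. -/
def IsClosedClass (M : Matrix (Fin n) (Fin n) ℝ) (C : Finset (Fin n)) : Prop :=
  ∀ i ∈ C, ∀ j, 0 < M i j → j ∈ C

theorem pow_nonneg_of_nonneg {M : Matrix (Fin n) (Fin n) ℝ} (hM : ∀ i j, 0 ≤ M i j) (t : ℕ)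
    (i j : Fin n) : 0 ≤ (M ^ t) i j := by
  induction t generalizing i j with
  | zero =>
    rw [pow_zero, Matrix.one_apply]
    split_ifs <;> norm_num
  | succ t ih =>
    rw [pow_succ, Matrix.mul_apply]
    exact Finset.sum_nonneg fun k _ => mul_nonneg (ih i k) (hM k j)

theorem IsClosedClass.pow {M : Matrix (Fin n) (Fin n) ℝ} (hM : ∀ i j, 0 ≤ M i j)
    {C : Finset (Fin n)} (hC : IsClosedClass M C) (t : ℕ) {i j : Fin n} (hi : i ∈ C)
    (hij : 0 < (M ^ t) i j) : j ∈ C := by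
  induction t generalizing j with
  | zero =>
    rw [pow_zero, Matrix.one_apply] at hij
    split_ifs at hij with h
    · exact h ▸ hi
    · exact absurd hij (lt_irrefl _)
  | succ t ih =>
    rw [pow_succ, Matrix.mul_apply] at hij
    obtain ⟨k, -, hk⟩ := Finset.exists_lt_of_sum_lt (s := Finset.univ) (f := fun _ => (0 : ℝ))
      (g := fun k => (M ^ t) i k * M k j) (by simpa using hij)
    have h1 := pow_nonneg_of_nonneg hM t i k
    have h2 := hM k j
    have h3 : 0 < (M ^ t) i k := h1.lt_of_ne fun h => by simp [← h] at hk
    have h4 : 0 < M k j := h2.lt_of_ne fun h => by simp [← h] at hk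
    exact hC k (ih h3) j h4

theorem Accessible.step {M : Matrix (Fin n) (Fin n) ℝ} (hM : ∀ i j, 0 ≤ M i j)
    {i j k : Fin n} (hij : Accessible M i j) (hjk : 0 < M j k) : Accessible M i k := by
  obtain ⟨t, ht⟩ := hij
  refine ⟨t + 1, ?_⟩
  rw [pow_succ, Matrix.mul_apply]
  exact (mul_pos ht hjk).trans_le (Finset.single_le_sum (f := fun l => (M ^ t) i l * M l k)
    (fun l _ => mul_nonneg (pow_nonneg_of_nonneg hM t i l) (hM l k)) (Finset.mem_univ j))

/-- Every nonempty closed set of states contains a recurrent class. -/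
theorem IsClosedClass.exists_isRecurrentClass {M : Matrix (Fin n) (Fin n) ℝ}
    (hM : ∀ i j, 0 ≤ M i j) {C : Finset (Fin n)} (hC : IsClosedClass M C) (hne : C.Nonempty) :
    ∃ D : Set (Fin n), IsRecurrentClass M D ∧ D ⊆ C := by
  classical
  induction C using Finset.strongInduction with
  | H C ih =>
    by_cases h : ∀ i ∈ C, ∀ j ∈ C, Accessible M i j
    · refine ⟨C, ⟨hne, fun i hi j => ⟨fun hj => h i hi j hj, ?_⟩⟩, subset_rfl⟩
      rintro ⟨t, ht⟩
      exact hC.pow hM t hi ht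
    · push Not at h
      obtain ⟨i, hi, j, hj, hij⟩ := h
      -- The states of `C` reachable from `i` form a closed set that misses `j`, hence a strictly
      -- smaller one.
      have hsub : C.filter (fun k => Accessible M i k) ⊂ C :=
        (Finset.filter_ssubset).2 ⟨j, hj, hij⟩
      have hcl : IsClosedClass M (C.filter fun k => Accessible M i k) := by
        intro k hk l hkl
        rw [Finset.mem_filter] at hk ⊢
        exact ⟨hC k hk.1 l hkl, hk.2.step hM hkl⟩
      obtain ⟨D, hD, hDC⟩ := ih _ hsub hcl
        ⟨i, Finset.mem_filter.2 ⟨hi, 0, by simp⟩⟩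
      exact ⟨D, hD, hDC.trans (by exact_mod_cast hsub.subset)⟩

/-! ### Weighted averages and long-run average rewards -/

theorem sum_mul_le_of_le {p d : Fin n → ℝ} (hp : ∀ j, 0 ≤ p j) (hp1 : ∑ j, p j = 1) {c : ℝ}
    (hd : ∀ j, d j ≤ c) : ∑ j, p j * d j ≤ c := by
  calc ∑ j, p j * d j ≤ ∑ j, p j * c :=
        Finset.sum_le_sum fun j _ => mul_le_mul_of_nonneg_left (hd j) (hp j)
    _ = c := by rw [← Finset.sum_mul, hp1, one_mul]

/-- If an average of numbers bounded by `c` is at least `c`, then every number with a positive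
weight is `c`. -/
theorem eq_of_le_sum_mul {p d : Fin n → ℝ} (hp : ∀ j, 0 ≤ p j) (hp1 : ∑ j, p j = 1) {c : ℝ}
    (hd : ∀ j, d j ≤ c) (h : c ≤ ∑ j, p j * d j) {j : Fin n} (hj : 0 < p j) : d j = c := by
  by_contra hne
  have hlt : d j < c := (hd j).lt_of_ne hne
  have : ∑ j, p j * d j < ∑ j, p j * c :=
    Finset.sum_lt_sum (fun j _ => mul_le_mul_of_nonneg_left (hd j) (hp j))
      ⟨j, Finset.mem_univ j, mul_lt_mul_of_pos_left hlt hj⟩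
  rw [← Finset.sum_mul, hp1, one_mul] at this
  exact absurd h (not_le.2 this)

theorem abs_pow_mulVec_le {M : Matrix (Fin n) (Fin n) ℝ} (hM : ∀ i j, 0 ≤ M i j)
    (hM1 : ∀ i, ∑ j, M i j = 1) {h : Fin n → ℝ} {c : ℝ} (hc : ∀ i, |h i| ≤ c) (t : ℕ)
    (i : Fin n) : |((M ^ t).mulVec h) i| ≤ c := by
  induction t generalizing i with
  | zero => simpa using hc i
  | succ t ih =>
    rw [pow_succ', ← Matrix.mulVec_mulVec, abs_le]
    constructor
    · have := sum_mul_le_of_le (d := fun j => -((M ^ t).mulVec h) j) (hM i) (hM1 i)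
        fun j => (neg_le_abs _).trans (ih j)
      simp only [mul_neg, Finset.sum_neg_distrib] at this
      simp only [Matrix.mulVec, dotProduct] at this ⊢
      linarith
    · exact sum_mul_le_of_le (hM i) (hM1 i) fun j => (le_abs_self _).trans (ih j)

/-- The average reward of a Markov chain is the constant of its evaluation equation. -/
theorem tendsto_average_of_evaluation {M : Matrix (Fin n) (Fin n) ℝ} (hM : ∀ i j, 0 ≤ M i j)
    (hM1 : ∀ i, ∑ j, M i j = 1) {v h : Fin n → ℝ} {g : ℝ}
    (hv : ∀ i, g + h i = v i + ∑ j, M i j * h j) (i : Fin n) :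
    Filter.Tendsto (fun T : ℕ => (∑ t ∈ Finset.range T, ((M ^ t).mulVec v) i) / (T : ℝ))
      Filter.atTop (nhds g) := by
  have hv' : v = (fun _ => g) + h - M.mulVec h := by
    funext k
    have := hv k
    simp only [Pi.sub_apply, Pi.add_apply, Matrix.mulVec, dotProduct]
    linarith
  have hconst : ∀ (t : ℕ) (k : Fin n), ((M ^ t).mulVec fun _ => g) k = g := by
    intro t
    induction t with
    | zero => simp
    | succ t ih =>
      intro k
      rw [pow_succ', ← Matrix.mulVec_mulVec, funext ih]
      simp [Matrix.mulVec, dotProduct, ← Finset.sum_mul, hM1]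
  -- Since `v = g + h - M h`, the partial sums telescope; the remainder is bounded and disappears
  -- after division by `T`.
  have hsum : ∀ T : ℕ, ∑ t ∈ Finset.range T, ((M ^ t).mulVec v) i
      = T * g + (h i - ((M ^ T).mulVec h) i) := by
    intro T
    induction T with
    | zero => simp
    | succ T ih =>
      rw [Finset.sum_range_succ, ih, hv', Matrix.mulVec_sub, Matrix.mulVec_add,
        Matrix.mulVec_mulVec, ← pow_succ]
      simp only [Pi.sub_apply, Pi.add_apply, hconst]
      push_cast
      ring
  obtain ⟨c, hc⟩ : ∃ c, ∀ k, |h k| ≤ c :=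
    ⟨∑ k, |h k|, fun k => Finset.single_le_sum (f := fun k => |h k|)
      (fun _ _ => abs_nonneg _) (Finset.mem_univ k)⟩
  have hlim : Filter.Tendsto (fun T : ℕ => (h i - ((M ^ T).mulVec h) i) / (T : ℝ))
      Filter.atTop (nhds 0) := by
    refine squeeze_zero_norm (a := fun T : ℕ => (2 * c) / (T : ℝ)) (fun T => ?_)
      (tendsto_const_div_atTop_nhds_zero_nat _)
    rw [Real.norm_eq_abs, abs_div, Nat.abs_cast]
    refine div_le_div_of_nonneg_right ?_ (Nat.cast_nonneg T)
    have h1 := abs_pow_mulVec_le hM hM1 hc T i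
    have h2 := hc i
    have h3 := abs_sub (h i) (((M ^ T).mulVec h) i)
    linarith
  have := hlim.const_add g
  rw [add_zero] at this
  refine this.congr' ?_
  filter_upwards [Filter.eventually_gt_atTop 0] with T hT
  have hT' : (T : ℝ) ≠ 0 := by exact_mod_cast hT.ne'
  rw [hsum]
  field_simp

end Stochastic

namespace Arm

variable {n : ℕ}

/-! ### The comparison principle -/

theorem act_of_mem {π : Finset (Fin n)} {i : Fin n} (h : i ∈ π) : act π i = 1 := if_pos h

theorem act_of_notMem {π : Finset (Fin n)} {i : Fin n} (h : i ∉ π) : act π i = 0 := if_neg h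

theorem exists_act_eq (a : Fin n → Fin 2) : ∃ π : Finset (Fin n), ∀ i, act π i = a i := by
  refine ⟨Finset.univ.filter fun i => a i = 1, fun i => ?_⟩
  by_cases h : a i = 1
  · rw [act_of_mem (by simp [h]), h]
  · rw [act_of_notMem (by simp [h])]
    omega

theorem Unichain.neZero {A : Arm n} (hA : A.Unichain) : NeZero n := by
  obtain ⟨C, ⟨⟨i, _⟩, _⟩, _⟩ := hA ∅
  exact ⟨by rintro rfl; exact i.elim0⟩

/-- If an amount can be added to `d` in every state without exceeding an average of `d` after one
transition, then this amount is nonpositive. -/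
theorem nonpos_of_add_le (A : Arm n) [NeZero n] {δ : ℝ} {d : Fin n → ℝ}
    (h : ∀ i, ∃ a, δ + d i ≤ ∑ j, A.P a i j * d j) : δ ≤ 0 := by
  obtain ⟨i, hi⟩ := Finite.exists_max d
  obtain ⟨a, ha⟩ := h i
  have := sum_mul_le_of_le (A.P_nonneg a i) (A.P_sum a i) hi
  linarith

/-- In a unichain arm, two nonempty sets of states that can each be made closed by a choice of
actions are not disjoint. -/
theorem Unichain.not_disjoint {A : Arm n} (hA : A.Unichain) {C D : Finset (Fin n)}
    (hC : C.Nonempty) (hD : D.Nonempty)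
    (hC' : ∀ i ∈ C, ∃ a, ∀ j, 0 < A.P a i j → j ∈ C)
    (hD' : ∀ i ∈ D, ∃ a, ∀ j, 0 < A.P a i j → j ∈ D) : ¬ Disjoint C D := by
  intro hdisj
  -- By disjointness a single policy can keep both sets closed. Each then contains a recurrent
  -- class, against uniqueness.
  have key : ∀ i, ∃ a, (i ∈ C → ∀ j, 0 < A.P a i j → j ∈ C) ∧
      (i ∈ D → ∀ j, 0 < A.P a i j → j ∈ D) := by
    intro i
    by_cases hi : i ∈ C
    · obtain ⟨a, ha⟩ := hC' i hi
      exact ⟨a, fun _ => ha, fun h => absurd h (Finset.disjoint_left.1 hdisj hi)⟩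
    · by_cases hi' : i ∈ D
      · obtain ⟨a, ha⟩ := hD' i hi'
        exact ⟨a, fun h => absurd h hi, fun _ => ha⟩
      · exact ⟨0, fun h => absurd h hi, fun h => absurd h hi'⟩
  choose a ha using key
  obtain ⟨π, hπ⟩ := exists_act_eq a
  have hM : ∀ i j, 0 ≤ A.trans π i j := fun i j => A.P_nonneg _ i j
  have hCc : IsClosedClass (A.trans π) C := fun i hi j hj =>
    (ha i).1 hi j (by simpa only [trans, hπ] using hj)
  have hDc : IsClosedClass (A.trans π) D := fun i hi j hj =>
    (ha i).2 hi j (by simpa only [trans, hπ] using hj)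
  obtain ⟨C₁, h₁, hs₁⟩ := hCc.exists_isRecurrentClass hM hC
  obtain ⟨D₁, h₂, hs₂⟩ := hDc.exists_isRecurrentClass hM hD
  obtain ⟨E, -, hE⟩ := hA π
  have heq : C₁ = D₁ := (hE C₁ h₁).trans (hE D₁ h₂).symm
  obtain ⟨x, hx⟩ := h₁.1
  exact Finset.disjoint_left.1 hdisj (hs₁ hx) (hs₂ (heq ▸ hx))

/-- The comparison principle of unichain arms. -/
theorem Unichain.eq_zero_and_const {A : Arm n} (hA : A.Unichain) {δ : ℝ} {d : Fin n → ℝ}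
    (hle : ∀ i, ∃ a, δ + d i ≤ ∑ j, A.P a i j * d j)
    (hge : ∀ i, ∃ a, ∑ j, A.P a i j * d j ≤ δ + d i) :
    δ = 0 ∧ ∀ i j, d i = d j := by
  classical
  have := hA.neZero
  have hge' : ∀ i, ∃ a, -δ + -d i ≤ ∑ j, A.P a i j * -d j := by
    intro i
    obtain ⟨a, ha⟩ := hge i
    refine ⟨a, ?_⟩
    simp only [mul_neg, Finset.sum_neg_distrib]
    linarith
  have h0 : δ = 0 := by
    have h1 := A.nonpos_of_add_le hle
    have h2 := A.nonpos_of_add_le (d := fun i => -d i) hge'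
    linarith
  refine ⟨h0, ?_⟩
  subst h0
  obtain ⟨x, hx⟩ := Finite.exists_max d
  obtain ⟨y, hy⟩ := Finite.exists_min d
  have hy' : ∀ j, -d j ≤ -d y := fun j => neg_le_neg (hy j)
  have hxy : d x = d y := by
    by_contra hne
    refine hA.not_disjoint (C := Finset.univ.filter fun i => d i = d x)
      (D := Finset.univ.filter fun i => d i = d y) ⟨x, by simp⟩ ⟨y, by simp⟩ ?_ ?_ ?_
    · intro i hi
      obtain ⟨a, ha⟩ := hle i
      rw [Finset.mem_filter] at hi
      refine ⟨a, fun j hj => Finset.mem_filter.2 ⟨Finset.mem_univ j, ?_⟩⟩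
      exact eq_of_le_sum_mul (A.P_nonneg a i) (A.P_sum a i) hx (by linarith) hj
    · intro i hi
      obtain ⟨a, ha⟩ := hge' i
      rw [Finset.mem_filter] at hi
      refine ⟨a, fun j hj => Finset.mem_filter.2 ⟨Finset.mem_univ j, ?_⟩⟩
      exact neg_injective
        (eq_of_le_sum_mul (A.P_nonneg a i) (A.P_sum a i) hy' (by linarith) hj)
    · rw [Finset.disjoint_left]
      intro i hi hi'
      exact hne ((Finset.mem_filter.1 hi).2.symm.trans (Finset.mem_filter.1 hi').2)
  have hall : ∀ i, d i = d x := fun i => le_antisymm (hx i) (hxy ▸ hy i)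
  exact fun i j => (hall i).trans (hall j).symm

/-! ### Policy evaluation and active advantages -/

theorem sum_P_const (A : Arm n) (a : Fin 2) (i : Fin n) (c : ℝ) : ∑ j, A.P a i j * c = c := by
  rw [← Finset.sum_mul, A.P_sum, one_mul]

/-- The evaluation equation of a policy of a unichain arm has a solution. -/
theorem Unichain.exists_evaluation {A : Arm n} (hA : A.Unichain) (π : Finset (Fin n))
    (v : Fin n → ℝ) :
    ∃ (g : ℝ) (h : Fin n → ℝ), ∀ i, g + h i = v i + ∑ j, A.P (act π i) i j * h j := by
  have := hA.neZero
  -- The normalisation `g = h 0` makes the system square, so the injectivity given by the comparison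
  -- principle yields solvability.
  let T : (Fin n → ℝ) →ₗ[ℝ] (Fin n → ℝ) :=
    { toFun := fun h i => h 0 + h i - ∑ j, A.P (act π i) i j * h j
      map_add' := by
        intro h h'
        funext i
        simp only [Pi.add_apply, mul_add, Finset.sum_add_distrib]
        ring
      map_smul' := by
        intro c h
        funext i
        simp only [Pi.smul_apply, smul_eq_mul, RingHom.id_apply, mul_sub, mul_add,
          Finset.mul_sum, mul_left_comm c] }
  have hT : ∀ h i, T h i = h 0 + h i - ∑ j, A.P (act π i) i j * h j := fun _ _ => rfl
  have hinj : Function.Injective T := by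
    rw [injective_iff_map_eq_zero]
    intro h hh
    have heq : ∀ i, h 0 + h i = ∑ j, A.P (act π i) i j * h j := by
      intro i
      have := congrFun hh i
      rw [hT, Pi.zero_apply] at this
      linarith
    obtain ⟨h0, hc⟩ := hA.eq_zero_and_const (fun i => ⟨_, (heq i).le⟩) (fun i => ⟨_, (heq i).ge⟩)
    funext i
    rw [hc i 0, h0, Pi.zero_apply]
  obtain ⟨h, hh⟩ := (LinearMap.injective_iff_surjective.1 hinj) v
  refine ⟨h 0, h, fun i => ?_⟩
  have := congrFun hh i
  rw [hT] at this
  linarith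

theorem Unichain.isBias_bias {A : Arm n} (hA : A.Unichain) (π : Finset (Fin n)) (lam : ℝ) :
    A.IsBias lam π (A.bias π lam) := by
  obtain ⟨g, h, hh⟩ := hA.exists_evaluation π fun i => A.reward lam (act π i) i
  exact Classical.epsilon_spec (p := fun h => A.IsBias lam π h) ⟨h, g, hh⟩

theorem actionValue_sub (A : Arm n) (lam : ℝ) (h h' : Fin n → ℝ) (a : Fin 2) (i : Fin n) :
    A.actionValue lam h a i - A.actionValue lam h' a i = ∑ j, A.P a i j * (h j - h' j) := by
  simp only [actionValue, mul_sub, Finset.sum_sub_distrib]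
  ring

theorem adv_eq (A : Arm n) (π : Finset (Fin n)) (i : Fin n) (lam : ℝ) :
    A.adv π i lam = A.actionValue lam (A.bias π lam) 1 i
      - A.actionValue lam (A.bias π lam) 0 i := by
  simp only [adv, actionValue, reward, sub_mul, Finset.sum_sub_distrib]
  simp
  ring

theorem actionValue_diff_eq_of_const (A : Arm n) (lam : ℝ) {h h' : Fin n → ℝ}
    (hc : ∀ i j, h i - h' i = h j - h' j) (i : Fin n) :
    A.actionValue lam h 1 i - A.actionValue lam h 0 i
      = A.actionValue lam h' 1 i - A.actionValue lam h' 0 i := by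
  have h1 := A.actionValue_sub lam h h' 1 i
  have h0 := A.actionValue_sub lam h h' 0 i
  rw [Finset.sum_congr rfl fun j _ => by rw [hc j i], sum_P_const] at h0 h1
  linarith

/-- The active advantage does not depend on the choice of the bias vector. -/
theorem Unichain.adv_eq_of_isBias {A : Arm n} (hA : A.Unichain) {π : Finset (Fin n)} {lam : ℝ}
    {h : Fin n → ℝ} (hh : A.IsBias lam π h) (i : Fin n) :
    A.adv π i lam = A.actionValue lam h 1 i - A.actionValue lam h 0 i := by
  rw [adv_eq]
  refine A.actionValue_diff_eq_of_const lam ?_ i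
  obtain ⟨g, hg⟩ := hA.isBias_bias π lam
  obtain ⟨g', hg'⟩ := hh
  have heq : ∀ i, (g - g') + (A.bias π lam i - h i)
      = ∑ j, A.P (act π i) i j * (A.bias π lam j - h j) := by
    intro i
    rw [← A.actionValue_sub lam, ← hg i, ← hg' i]
    ring
  exact (hA.eq_zero_and_const (d := fun i => A.bias π lam i - h i)
    (fun i => ⟨_, (heq i).le⟩) (fun i => ⟨_, (heq i).ge⟩)).2

/-- Two policies have the same active advantages if these have opposite signs in every state in
which the policies differ. -/
theorem Unichain.adv_eq_adv {A : Arm n} (hA : A.Unichain) {π ρ : Finset (Fin n)} {lam : ℝ}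
    (hs : ∀ i, ¬ (i ∈ π ↔ i ∈ ρ) → A.adv π i lam * A.adv ρ i lam ≤ 0) (i : Fin n) :
    A.adv π i lam = A.adv ρ i lam := by
  have hadvπ := fun i => A.adv_eq π i lam
  have hadvρ := fun i => A.adv_eq ρ i lam
  rw [hadvπ, hadvρ]
  refine A.actionValue_diff_eq_of_const lam ?_ i
  obtain ⟨g, hg⟩ := hA.isBias_bias π lam
  obtain ⟨g', hg'⟩ := hA.isBias_bias ρ lam
  -- Where only `π` is active, the left side equals the average for action 1 plus the advantage
  -- under `ρ`, and the average for action 0 plus the advantage under `π`. Opposite signs place it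
  -- between the two averages; the other case of disagreement is symmetric.
  have key : ∀ i, (∃ a, (g - g') + (A.bias π lam i - A.bias ρ lam i)
        ≤ ∑ j, A.P a i j * (A.bias π lam j - A.bias ρ lam j)) ∧
      ∃ a, ∑ j, A.P a i j * (A.bias π lam j - A.bias ρ lam j)
        ≤ (g - g') + (A.bias π lam i - A.bias ρ lam i) := by
    intro i
    simp only [← A.actionValue_sub lam]
    have e := hg i
    have e' := hg' i
    have aπ := hadvπ i
    have aρ := hadvρ i
    have s := hs i
    by_cases hπ : i ∈ π <;> by_cases hρ : i ∈ ρ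
    · rw [act_of_mem hπ] at e
      rw [act_of_mem hρ] at e'
      exact ⟨⟨1, by linarith⟩, ⟨1, by linarith⟩⟩
    · rw [act_of_mem hπ] at e
      rw [act_of_notMem hρ] at e'
      rcases mul_nonpos_iff.1 (s (by tauto)) with h | h
      · exact ⟨⟨1, by linarith⟩, ⟨0, by linarith⟩⟩
      · exact ⟨⟨0, by linarith⟩, ⟨1, by linarith⟩⟩
    · rw [act_of_notMem hπ] at e
      rw [act_of_mem hρ] at e'
      rcases mul_nonpos_iff.1 (s (by tauto)) with h | h
      · exact ⟨⟨1, by linarith⟩, ⟨0, by linarith⟩⟩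
      · exact ⟨⟨0, by linarith⟩, ⟨1, by linarith⟩⟩
    · rw [act_of_notMem hπ] at e
      rw [act_of_notMem hρ] at e'
      exact ⟨⟨0, by linarith⟩, ⟨0, by linarith⟩⟩
  exact (hA.eq_zero_and_const (d := fun i => A.bias π lam i - A.bias ρ lam i)
    (fun i => (key i).1) (fun i => (key i).2)).2

/-! ### Dependence of the advantages on the penalty -/

theorem actionValue_affine (A : Arm n) (lam : ℝ) (h h' : Fin n → ℝ) (a : Fin 2) (i : Fin n) :
    A.actionValue lam (fun j => h j + lam * (h' j - h j)) a i
      = A.actionValue 0 h a i + lam * (A.actionValue 1 h' a i - A.actionValue 0 h a i) := by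
  simp only [actionValue, reward, mul_add, mul_sub, Finset.sum_add_distrib,
    Finset.sum_sub_distrib, Finset.mul_sum, mul_left_comm lam]
  ring

/-- The active advantage is an affine function of the penalty. -/
theorem Unichain.adv_affine {A : Arm n} (hA : A.Unichain) (π : Finset (Fin n)) (i : Fin n)
    (lam : ℝ) :
    A.adv π i lam = A.adv π i 0 + lam * (A.adv π i 1 - A.adv π i 0) := by
  obtain ⟨g, hg⟩ := hA.isBias_bias π 0
  obtain ⟨g', hg'⟩ := hA.isBias_bias π 1
  have hb : A.IsBias lam π
      fun j => A.bias π 0 j + lam * (A.bias π 1 j - A.bias π 0 j) := by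
    refine ⟨g + lam * (g' - g), fun i => ?_⟩
    rw [actionValue_affine, ← hg i, ← hg' i]
    ring
  rw [hA.adv_eq_of_isBias hb, adv_eq, adv_eq, actionValue_affine, actionValue_affine]
  ring

theorem actionValue_zero_penalty (A : Arm n) (lam : ℝ) (h : Fin n → ℝ) (a : Fin 2) (i : Fin n) :
    A.actionValue lam h a i = A.actionValue 0 h a i - lam * ((a : ℕ) : ℝ) := by
  simp only [actionValue, reward]
  ring

/-- The penalty is paid in every period, so it lowers the gain by `lam` and leaves the bias
unchanged. -/
theorem Unichain.adv_univ {A : Arm n} (hA : A.Unichain) (i : Fin n) (lam : ℝ) :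
    A.adv Finset.univ i lam = A.adv Finset.univ i 0 - lam := by
  obtain ⟨g, hg⟩ := hA.isBias_bias Finset.univ 0
  have hb : A.IsBias lam Finset.univ (A.bias Finset.univ 0) := by
    refine ⟨g - lam, fun i => ?_⟩
    rw [actionValue_zero_penalty, ← hg i, act_of_mem (Finset.mem_univ i)]
    simp
    ring
  rw [hA.adv_eq_of_isBias hb, adv_eq, actionValue_zero_penalty, A.actionValue_zero_penalty lam _ 0]
  simp
  ring

/-- The penalty is never paid, so the gain and the bias do not depend on it. -/
theorem Unichain.adv_empty {A : Arm n} (hA : A.Unichain) (i : Fin n) (lam : ℝ) :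
    A.adv ∅ i lam = A.adv ∅ i 0 - lam := by
  obtain ⟨g, hg⟩ := hA.isBias_bias ∅ 0
  have hb : A.IsBias lam ∅ (A.bias ∅ 0) := by
    refine ⟨g, fun i => ?_⟩
    rw [actionValue_zero_penalty, ← hg i, act_of_notMem (Finset.notMem_empty i)]
    simp
  rw [hA.adv_eq_of_isBias hb, adv_eq, actionValue_zero_penalty, A.actionValue_zero_penalty lam _ 0]
  simp
  ring

/-! ### Greedy policies and Bellman optimality -/

/-- No change of action in a state of `F` improves on the policy `π`. -/
def GreedyOn (A : Arm n) (F : Finset (Fin n)) (lam : ℝ) (π : Finset (Fin n)) : Prop :=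
  ∀ i ∈ F, (i ∈ π → 0 ≤ A.adv π i lam) ∧ (i ∉ π → A.adv π i lam ≤ 0)

/-- No change of action in any state improves on the policy `π`. -/
def Greedy (A : Arm n) (lam : ℝ) (π : Finset (Fin n)) : Prop :=
  ∀ i, (i ∈ π → 0 ≤ A.adv π i lam) ∧ (i ∉ π → A.adv π i lam ≤ 0)

/-- States outside `F` are frozen. When `s` is released, the candidates are the policies obtained
with `s` frozen active and frozen passive. If both wanted to change at `s`, their advantages would
have opposite signs wherever they differ, hence be equal, which is absurd at `s`. -/
theorem Unichain.exists_greedyOn {A : Arm n} (hA : A.Unichain) (lam : ℝ) (F : Finset (Fin n)) :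
    ∀ π : Finset (Fin n), ∃ ρ, A.GreedyOn F lam ρ ∧ ∀ i, i ∉ F → (i ∈ ρ ↔ i ∈ π) := by
  classical
  induction F using Finset.induction_on with
  | empty => exact fun π => ⟨π, by simp [GreedyOn], by simp⟩
  | insert s F hs ih =>
    intro π
    obtain ⟨ρ₁, hρ₁, he₁⟩ := ih (insert s π)
    obtain ⟨ρ₀, hρ₀, he₀⟩ := ih (π.erase s)
    have hs₁ : s ∈ ρ₁ := (he₁ s hs).2 (Finset.mem_insert_self s π)
    have hs₀ : s ∉ ρ₀ := fun h => by simpa using (he₀ s hs).1 h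
    by_cases h₁ : 0 ≤ A.adv ρ₁ s lam
    · refine ⟨ρ₁, fun i hi => ?_, fun i hi => ?_⟩
      · rcases Finset.mem_insert.1 hi with rfl | hi
        · exact ⟨fun _ => h₁, fun h => absurd hs₁ h⟩
        · exact hρ₁ i hi
      · rw [Finset.mem_insert, not_or] at hi
        rw [he₁ i hi.2, Finset.mem_insert, or_iff_right hi.1]
    by_cases h₀ : A.adv ρ₀ s lam ≤ 0
    · refine ⟨ρ₀, fun i hi => ?_, fun i hi => ?_⟩
      · rcases Finset.mem_insert.1 hi with rfl | hi
        · exact ⟨fun h => absurd h hs₀, fun _ => h₀⟩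
        · exact hρ₀ i hi
      · rw [Finset.mem_insert, not_or] at hi
        rw [he₀ i hi.2, Finset.mem_erase, and_iff_right hi.1]
    exfalso
    push Not at h₁ h₀
    have := hA.adv_eq_adv (π := ρ₁) (ρ := ρ₀) (lam := lam) (fun i hi => by
      by_cases his : i = s
      · subst his
        exact mul_nonpos_of_nonpos_of_nonneg h₁.le h₀.le
      by_cases hiF : i ∈ F
      · have a := hρ₁ i hiF
        have b := hρ₀ i hiF
        by_cases h : i ∈ ρ₁
        · exact mul_nonpos_of_nonneg_of_nonpos (a.1 h) (b.2 (by tauto))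
        · exact mul_nonpos_of_nonpos_of_nonneg (a.2 h) (b.1 (by tauto))
      · exfalso
        rw [he₁ i hiF, he₀ i hiF, Finset.mem_insert, Finset.mem_erase] at hi
        tauto) s
    linarith

theorem Unichain.exists_greedy {A : Arm n} (hA : A.Unichain) (lam : ℝ) :
    ∃ π, A.Greedy lam π := by
  obtain ⟨ρ, hρ, -⟩ := hA.exists_greedyOn lam Finset.univ ∅
  exact ⟨ρ, fun i => hρ i (Finset.mem_univ i)⟩

theorem hasGain_of_evaluation (A : Arm n) {lam g : ℝ} {π : Finset (Fin n)} {h : Fin n → ℝ}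
    (hg : ∀ i, g + h i = A.actionValue lam h (act π i) i) (i : Fin n) : A.HasGain lam π i g :=
  tendsto_average_of_evaluation (M := A.trans π) (v := fun j => A.reward lam (act π j) j)
    (fun i j => A.P_nonneg (act π i) i j) (fun i => A.P_sum (act π i) i) (fun i => hg i) i

theorem Unichain.bellmanOptimal_iff_greedy {A : Arm n} (hA : A.Unichain) {lam : ℝ}
    {π : Finset (Fin n)} : A.BellmanOptimal lam π ↔ A.Greedy lam π := by
  have := hA.neZero
  constructor
  · rintro ⟨g, h, -, hB, hπ⟩ i
    have hb : A.IsBias lam π h := ⟨g, fun i => (hB i).trans (hπ i).symm⟩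
    rw [hA.adv_eq_of_isBias hb]
    have hi := hπ i
    refine ⟨fun hm => ?_, fun hm => ?_⟩
    · rw [act_of_mem hm] at hi
      have := le_max_left (A.actionValue lam h 0 i) (A.actionValue lam h 1 i)
      linarith
    · rw [act_of_notMem hm] at hi
      have := le_max_right (A.actionValue lam h 0 i) (A.actionValue lam h 1 i)
      linarith
  · intro hG
    obtain ⟨g, hg⟩ := hA.isBias_bias π lam
    have hmax : ∀ i, A.actionValue lam (A.bias π lam) (act π i) i
        = max (A.actionValue lam (A.bias π lam) 0 i) (A.actionValue lam (A.bias π lam) 1 i) := by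
      intro i
      have hi := hG i
      rw [adv_eq] at hi
      by_cases hm : i ∈ π
      · rw [act_of_mem hm, max_eq_right (by linarith [hi.1 hm])]
      · rw [act_of_notMem hm, max_eq_left (by linarith [hi.2 hm])]
    refine ⟨g, A.bias π lam, fun i => ⟨⟨π, ?_⟩, ?_⟩, fun i => (hg i).trans (hmax i), hmax⟩
    · exact A.hasGain_of_evaluation hg i
    · rintro x ⟨ρ, hρ⟩
      obtain ⟨g', hg'⟩ := hA.isBias_bias ρ lam
      have hx : x = g' := tendsto_nhds_unique hρ (A.hasGain_of_evaluation hg' i)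
      -- The actions of `ρ` are suboptimal for the bias of `π`, so a maximum of the difference of
      -- biases forces `g' ≤ g`.
      have := A.nonpos_of_add_le (δ := g' - g)
        (d := fun i => A.bias ρ lam i - A.bias π lam i) fun i => ⟨act ρ i, by
          rw [← A.actionValue_sub lam, ← hg' i]
          have hle : A.actionValue lam (A.bias π lam) (act ρ i) i ≤ g + A.bias π lam i := by
            rw [hg i, hmax i]
            by_cases hm : i ∈ ρ
            · rw [act_of_mem hm]
              exact le_max_right _ _
            · rw [act_of_notMem hm]
              exact le_max_left _ _
          linarith⟩
      linarith

theorem Unichain.adv_eq_of_greedy {A : Arm n} (hA : A.Unichain) {lam : ℝ}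
    {π ρ : Finset (Fin n)} (hπ : A.Greedy lam π) (hρ : A.Greedy lam ρ) (i : Fin n) :
    A.adv π i lam = A.adv ρ i lam := by
  refine hA.adv_eq_adv (fun i hi => ?_) i
  by_cases h : i ∈ π
  · exact mul_nonpos_of_nonneg_of_nonpos ((hπ i).1 h) ((hρ i).2 (by tauto))
  · exact mul_nonpos_of_nonpos_of_nonneg ((hπ i).2 h) ((hρ i).1 (by tauto))

theorem Unichain.adv_erase {A : Arm n} (hA : A.Unichain) {lam : ℝ} {π : Finset (Fin n)}
    {s : Fin n} (hs : A.adv π s lam = 0) (i : Fin n) :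
    A.adv (π.erase s) i lam = A.adv π i lam := by
  refine hA.adv_eq_adv (fun j hj => ?_) i
  have : j = s := by
    by_contra h
    exact hj (by simp [h])
  rw [this, hs, mul_zero]

theorem Unichain.adv_insert {A : Arm n} (hA : A.Unichain) {lam : ℝ} {π : Finset (Fin n)}
    {s : Fin n} (hs : A.adv π s lam = 0) (i : Fin n) :
    A.adv (insert s π) i lam = A.adv π i lam := by
  refine hA.adv_eq_adv (fun j hj => ?_) i
  have : j = s := by
    by_contra h
    exact hj (by simp [h])
  rw [this, hs, mul_zero]

theorem Unichain.greedy_erase {A : Arm n} (hA : A.Unichain) {lam : ℝ} {π : Finset (Fin n)}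
    (hπ : A.Greedy lam π) {s : Fin n} (hs : A.adv π s lam ≤ 0) : A.Greedy lam (π.erase s) := by
  by_cases hm : s ∈ π
  · have h0 : A.adv π s lam = 0 := le_antisymm hs ((hπ s).1 hm)
    intro i
    rw [hA.adv_erase h0, Finset.mem_erase]
    refine ⟨fun h => (hπ i).1 h.2, fun h => ?_⟩
    by_cases his : i = s
    · rw [his, h0]
    · exact (hπ i).2 fun h' => h ⟨his, h'⟩
  · rwa [Finset.erase_eq_of_notMem hm]

theorem Unichain.greedy_insert {A : Arm n} (hA : A.Unichain) {lam : ℝ} {π : Finset (Fin n)}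
    (hπ : A.Greedy lam π) {s : Fin n} (hs : 0 ≤ A.adv π s lam) : A.Greedy lam (insert s π) := by
  by_cases hm : s ∈ π
  · rwa [Finset.insert_eq_of_mem hm]
  · have h0 : A.adv π s lam = 0 := le_antisymm ((hπ s).2 hm) hs
    intro i
    rw [hA.adv_insert h0, Finset.mem_insert]
    refine ⟨fun h => ?_, fun h => (hπ i).2 fun h' => h (Or.inr h')⟩
    rcases h with h | h
    · rw [h, h0]
    · exact (hπ i).1 h

/-! ### Optimal advantages and indexability -/

/-- The active advantage under an optimal policy. -/
noncomputable def optAdv (A : Arm n) (i : Fin n) (lam : ℝ) : ℝ :=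
  A.adv (Classical.epsilon fun π => A.Greedy lam π) i lam

theorem Unichain.adv_eq_optAdv {A : Arm n} (hA : A.Unichain) {lam : ℝ} {π : Finset (Fin n)}
    (hπ : A.Greedy lam π) (i : Fin n) : A.adv π i lam = A.optAdv i lam :=
  hA.adv_eq_of_greedy hπ (Classical.epsilon_spec (p := fun π => A.Greedy lam π) ⟨π, hπ⟩) i

/-- An arm is indexable if and only if the optimal active advantage of every state goes once and
for all from positive to negative values, vanishing at most once. -/
theorem Unichain.indexable_iff {A : Arm n} (hA : A.Unichain) :
    A.Indexable ↔ ∀ i (lam lam' : ℝ), lam < lam' → 0 ≤ A.optAdv i lam' → 0 < A.optAdv i lam := by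
  constructor
  · intro h i lam lam' hlt h'
    by_contra hneg
    push Not at hneg
    obtain ⟨π, hπ⟩ := hA.exists_greedy lam
    obtain ⟨π', hπ'⟩ := hA.exists_greedy lam'
    rw [← hA.adv_eq_optAdv hπ] at hneg
    rw [← hA.adv_eq_optAdv hπ'] at h'
    -- These signs allow an optimal policy without `i` at `lam` and one with `i` at `lam'`.
    have := h lam lam' hlt _ _ (hA.bellmanOptimal_iff_greedy.2 (hA.greedy_erase hπ hneg))
      (hA.bellmanOptimal_iff_greedy.2 (hA.greedy_insert hπ' h')) (Finset.mem_insert_self i π')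
    simp at this
  · intro h lam lam' hlt π π' hπ hπ' i hi
    rw [hA.bellmanOptimal_iff_greedy] at hπ hπ'
    have h1 := h i lam lam' hlt (by
      rw [← hA.adv_eq_optAdv hπ']
      exact (hπ' i).1 hi)
    rw [← hA.adv_eq_optAdv hπ] at h1
    by_contra hm
    exact absurd h1 (not_lt.2 ((hπ i).2 hm))

/-! ### Sign changes and the next penalty -/

theorem Unichain.continuous_adv {A : Arm n} (hA : A.Unichain) (π : Finset (Fin n)) (i : Fin n) :
    Continuous (A.adv π i) := by
  rw [funext (hA.adv_affine π i)]
  fun_prop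

/-- An affine function is controlled by its endpoints; this is why passive states need testing only
at the next penalty. -/
theorem Unichain.adv_neg_of_mem_Ioc {A : Arm n} (hA : A.Unichain) {π : Finset (Fin n)}
    {i : Fin n} {a b x : ℝ} (ha : A.adv π i a ≤ 0) (hb : A.adv π i b < 0) (hax : a < x)
    (hxb : x ≤ b) : A.adv π i x < 0 := by
  rw [hA.adv_affine] at ha hb ⊢
  by_contra h
  push Not at h
  nlinarith [mul_nonneg (sub_nonneg.2 hxb) (neg_nonneg.2 ha),
    mul_pos (sub_pos.2 hax) (neg_pos.2 hb), mul_nonneg (sub_nonneg.2 (hax.le.trans hxb)) h]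

/-- If the active advantages of the active states do not vanish between two penalties, then they
keep their sign. -/
theorem Unichain.adv_pos_of_ne_zero {A : Arm n} (hA : A.Unichain) {π : Finset (Fin n)}
    {i : Fin n} {a x : ℝ} (ha : 0 ≤ A.adv π i a) (hax : a ≤ x)
    (hne : ∀ y, a ≤ y → y ≤ x → A.adv π i y ≠ 0) : 0 < A.adv π i x := by
  by_contra h
  push Not at h
  obtain ⟨y, hy, hy0⟩ := intermediate_value_Icc' hax
    (hA.continuous_adv π i).continuousOn ⟨h, ha⟩
  exact hne y hy.1 hy.2 hy0

/-- Some penalty is so large that the active advantages under the policy of permanent rest are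
negative from then on. -/
theorem Unichain.exists_forall_adv_empty_neg {A : Arm n} (hA : A.Unichain) :
    ∃ b : ℝ, ∀ lam, b < lam → ∀ i, A.adv ∅ i lam < 0 := by
  obtain ⟨b, hb⟩ := Finite.bddAbove_range fun i => A.adv ∅ i 0
  refine ⟨b, fun lam hlam i => ?_⟩
  rw [hA.adv_empty]
  have : A.adv ∅ i 0 ≤ b := hb ⟨i, rfl⟩
  linarith

theorem Unichain.exists_forall_adv_univ_pos {A : Arm n} (hA : A.Unichain) :
    ∃ b : ℝ, ∀ lam, lam ≤ b → ∀ i, 0 < A.adv Finset.univ i lam := by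
  obtain ⟨b, hb⟩ := Finite.bddBelow_range fun i => A.adv Finset.univ i 0
  refine ⟨b - 1, fun lam hlam i => ?_⟩
  rw [hA.adv_univ]
  have : b ≤ A.adv Finset.univ i 0 := hb ⟨i, rfl⟩
  linarith

/-- The next penalty of a nonempty policy is finite. -/
theorem Unichain.exists_nextPenalty_eq {A : Arm n} (hA : A.Unichain) {π : Finset (Fin n)}
    (hne : π.Nonempty) {μ : ℝ} (hμ : ∀ i ∈ π, 0 ≤ A.adv π i μ) :
    ∃ ν : ℝ, A.nextPenalty π μ = ν ∧ μ ≤ ν ∧ (∃ i ∈ π, A.adv π i ν = 0) ∧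
      ∀ lam, μ ≤ lam → lam < ν → ∀ i ∈ π, A.adv π i lam ≠ 0 := by
  let S : Set ℝ := {lam | μ ≤ lam ∧ ∃ i ∈ π, A.adv π i lam = 0}
  -- Without a zero, the advantages under `π` of its states stay positive, while those under `∅`
  -- become negative. By comparison the two policies would then have equal advantages.
  have hSne : S.Nonempty := by
    by_contra hemp
    rw [Set.not_nonempty_iff_eq_empty] at hemp
    obtain ⟨b, hb⟩ := hA.exists_forall_adv_empty_neg
    have hpos : ∀ i ∈ π, 0 < A.adv π i (max μ (b + 1)) := fun i hi =>
      hA.adv_pos_of_ne_zero (hμ i hi) (le_max_left _ _) fun y hy _ h0 => by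
        have : y ∈ S := ⟨hy, i, hi, h0⟩
        simp [hemp] at this
    have hneg := hb (max μ (b + 1)) (lt_of_lt_of_le (by linarith) (le_max_right _ _))
    obtain ⟨i, hi⟩ := hne
    have := hA.adv_eq_adv (π := π) (ρ := ∅) (fun j hj =>
      mul_nonpos_of_nonneg_of_nonpos (hpos j (by simpa using hj)).le (hneg j).le) i
    linarith [hpos i hi, hneg i]
  have hScl : IsClosed S := by
    have : S = Set.Ici μ ∩ ⋃ i ∈ π, {lam | A.adv π i lam = 0} := by
      ext lam
      simp [S]
    rw [this]
    exact isClosed_Ici.inter (π.finite_toSet.isClosed_biUnion fun i _ =>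
      isClosed_eq (hA.continuous_adv π i) continuous_const)
  have hSb : BddBelow S := ⟨μ, fun x hx => hx.1⟩
  have hmem : sInf S ∈ S := hScl.csInf_mem hSne hSb
  refine ⟨sInf S, ?_, hmem.1, hmem.2, fun lam hlam hlt i hi h0 =>
    absurd (csInf_le hSb ⟨hlam, i, hi, h0⟩) (not_le.2 hlt)⟩
  refine IsLeast.csInf_eq ⟨⟨sInf S, rfl, by exact_mod_cast hmem.1, hmem.2⟩, ?_⟩
  rintro x ⟨lam, rfl, hlam, h⟩
  exact_mod_cast csInf_le hSb ⟨by exact_mod_cast hlam, h⟩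

/-! ### Correctness of the main loop -/

/-- The invariant of the main loop: the policy `π` is optimal for the penalty `μ`, its states are
strictly active below `μ`, and every other state has passed once from strictly active to strictly
passive. -/
structure LoopInvariant (A : Arm n) (π : Finset (Fin n)) (μ : ℝ) : Prop where
  greedy : A.Greedy μ π
  active : ∀ i ∈ π, ∀ lam < μ, 0 < A.optAdv i lam
  passive : ∀ i ∉ π, ∃ l ≤ μ, A.optAdv i l = 0 ∧ (∀ lam < l, 0 < A.optAdv i lam) ∧
    ∀ lam, l < lam → lam ≤ μ → A.optAdv i lam < 0

/-- Beyond `μ` permanent rest remains greedy, because its advantages decrease with slope `-1`; no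
state can become active again. -/
theorem LoopInvariant.indexable {A : Arm n} (hA : A.Unichain) {μ : ℝ}
    (h : A.LoopInvariant ∅ μ) : A.Indexable := by
  rw [hA.indexable_iff]
  intro i lam lam' hlt h'
  obtain ⟨l, hl, -, hpos, hneg⟩ := h.passive i (Finset.notMem_empty i)
  refine hpos lam (hlt.trans_le ?_)
  by_contra! hll
  rcases le_or_gt lam' μ with hle | hgt
  · exact absurd h' (not_le.2 (hneg lam' hll hle))
  · have hadv : ∀ j, A.adv ∅ j lam' < 0 := fun j => by
      have h1 := (h.greedy j).2 (Finset.notMem_empty j)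
      rw [hA.adv_empty] at h1 ⊢
      linarith
    have hG : A.Greedy lam' ∅ := fun j =>
      ⟨fun hj => absurd hj (Finset.notMem_empty j), fun _ => (hadv j).le⟩
    have := hadv i
    rw [hA.adv_eq_optAdv hG] at this
    exact absurd h' (not_le.2 this)

/-- If some passive state wants to become active at the next penalty, the arm is not indexable. -/
theorem LoopInvariant.not_indexable {A : Arm n} (hA : A.Unichain) {π : Finset (Fin n)} {μ ν : ℝ}
    (h : A.LoopInvariant π μ) (hlt : μ < ν) (hν : ∀ i ∈ π, 0 ≤ A.adv π i ν) {j : Fin n}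
    (hj : j ∉ π) (hjν : 0 ≤ A.adv π j ν) : ¬ A.Indexable := by
  rw [hA.indexable_iff]
  intro hI
  have hneg : ∀ i ∉ π, A.optAdv i ν < 0 := by
    intro i hi
    obtain ⟨l, hl, h0, -⟩ := h.passive i hi
    by_contra! hc
    exact (hI i l ν (hl.trans_lt hlt) hc).ne' h0
  obtain ⟨ρ, hρ⟩ := hA.exists_greedy ν
  -- Under indexability the passive states stay passive at `ν`. So `ρ` can only deactivate states of
  -- `π`, where the advantages have opposite signs, and the two policies have equal advantages.
  have hsub : ρ ⊆ π := by
    intro i hi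
    by_contra hc
    have := hneg i hc
    rw [← hA.adv_eq_optAdv hρ] at this
    exact absurd ((hρ i).1 hi) (not_le.2 this)
  have := hA.adv_eq_adv (π := π) (ρ := ρ) (lam := ν) (fun i hi => by
    have hiρ : i ∉ ρ := fun hc => hi ⟨fun _ => hc, fun _ => hsub hc⟩
    have hiπ : i ∈ π := by tauto
    exact mul_nonpos_of_nonneg_of_nonpos (hν i hiπ) ((hρ i).2 hiρ)) j
  rw [hA.adv_eq_optAdv hρ] at this
  linarith [hneg j hj]

/-- The policy `π` is greedy on all of `[μ, ν]`, so its advantages are the optimal ones there. The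
erased state crosses zero exactly at `ν`. When `μ = ν` no test is needed, as greediness is
inherited. -/
theorem LoopInvariant.erase {A : Arm n} (hA : A.Unichain) {π : Finset (Fin n)} {μ ν : ℝ}
    (h : A.LoopInvariant π μ) (hle : μ ≤ ν) (hν : ∀ i ∈ π, 0 ≤ A.adv π i ν)
    (hpos : ∀ lam, μ ≤ lam → lam < ν → ∀ i ∈ π, 0 < A.adv π i lam)
    (htest : μ < ν → ∀ j ∉ π, A.adv π j ν < 0) {s : Fin n} (hs : s ∈ π)
    (hs0 : A.adv π s ν = 0) : A.LoopInvariant (π.erase s) ν := by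
  have hpas : ∀ lam, μ < lam → lam ≤ ν → ∀ j ∉ π, A.adv π j lam < 0 := fun lam h1 h2 j hj =>
    hA.adv_neg_of_mem_Ioc ((h.greedy j).2 hj) (htest (h1.trans_le h2) j hj) h1 h2
  have hG : ∀ lam, μ ≤ lam → lam ≤ ν → A.Greedy lam π := by
    intro lam h1 h2 i
    refine ⟨fun hi => ?_, fun hi => ?_⟩
    · rcases h2.lt_or_eq with h2 | rfl
      · exact (hpos lam h1 h2 i hi).le
      · exact hν i hi
    · rcases h1.lt_or_eq with h1 | rfl
      · exact (hpas lam h1 h2 i hi).le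
      · exact (h.greedy i).2 hi
  have hact : ∀ i ∈ π, ∀ lam < ν, 0 < A.optAdv i lam := by
    intro i hi lam hlam
    rcases lt_or_ge lam μ with hlt | hge
    · exact h.active i hi lam hlt
    · rw [← hA.adv_eq_optAdv (hG lam hge hlam.le)]
      exact hpos lam hge hlam i hi
  have hGν := hG ν hle le_rfl
  refine ⟨hA.greedy_erase hGν hs0.le, fun i hi => hact i (Finset.mem_of_mem_erase hi), ?_⟩
  intro i hi
  by_cases his : i = s
  · subst his
    exact ⟨ν, le_rfl, by rw [← hA.adv_eq_optAdv hGν, hs0], hact i hs,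
      fun lam h1 h2 => absurd h1 (not_lt.2 h2)⟩
  · have hiπ : i ∉ π := fun hc => hi (Finset.mem_erase.2 ⟨his, hc⟩)
    obtain ⟨l, hl, h0, hlpos, hlneg⟩ := h.passive i hiπ
    refine ⟨l, hl.trans hle, h0, hlpos, fun lam h1 h2 => ?_⟩
    rcases le_or_gt lam μ with hm | hm
    · exact hlneg lam h1 hm
    · rw [← hA.adv_eq_optAdv (hG lam hm.le h2)]
      exact hpas lam hm h2 i hiπ

/-- The main loop is correct when it starts from a state that satisfies its invariant. -/
theorem LoopInvariant.loop_correct {A : Arm n} (hA : A.Unichain)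
    {choice : Finset (Fin n) → Fin n}
    (hchoice : ∀ s : Finset (Fin n), s.Nonempty → choice s ∈ s) (m : ℕ) :
    ∀ (π : Finset (Fin n)) (μ : ℝ) (index : Fin n → EReal), π.card = m → A.LoopInvariant π μ →
      ((∃ index', A.loop choice m π μ index = Output.indexable index') ↔ A.Indexable) ∧
        A.loop choice m π μ index ≠ Output.multichain := by
  classical
  induction m with
  | zero =>
    intro π μ index hcard h
    rw [Finset.card_eq_zero] at hcard
    subst hcard
    simp [loop, h.indexable hA]
  | succ m ih =>
    intro π μ index hcard h
    have hne : π.Nonempty := Finset.card_pos.1 (by omega)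
    have hμ : ∀ i ∈ π, 0 ≤ A.adv π i μ := fun i hi => (h.greedy i).1 hi
    obtain ⟨ν, hνeq, hle, ⟨z, hz, hz0⟩, hnz⟩ := hA.exists_nextPenalty_eq hne hμ
    have hpos : ∀ lam, μ ≤ lam → lam < ν → ∀ i ∈ π, 0 < A.adv π i lam := fun lam h1 h2 i hi =>
      hA.adv_pos_of_ne_zero (hμ i hi) h1 fun y hy hy' => hnz y hy (hy'.trans_lt h2) i hi
    have hν : ∀ i ∈ π, 0 ≤ A.adv π i ν := by
      intro i hi
      by_contra! hc
      -- Half of a negative value at `ν` would be taken strictly before `ν`, where the advantage is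
      -- positive.
      obtain ⟨y, hy, hy0⟩ := intermediate_value_Ioo' hle
        (hA.continuous_adv π i).continuousOn
        (show A.adv π i ν / 2 ∈ Set.Ioo (A.adv π i ν) (A.adv π i μ) from
          ⟨by linarith, by linarith [hμ i hi]⟩)
      linarith [hpos y hy.1.le hy.2 i hi]
    have hadvE : ∀ i, A.advE π i (ν : EReal) = (A.adv π i ν : EReal) := fun i => rfl
    have huni : ∀ ρ, A.UnichainPolicy ρ := hA
    -- The penalty is finite and every policy is unichain, so only the test and the recursive call
    -- remain.
    simp only [loop, hνeq, EReal.coe_ne_top, if_false, hadvE, huni, not_true_eq_false]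
    split_ifs with htest
    · obtain ⟨hlt, j, hj, hjν⟩ := htest
      have hnot := h.not_indexable hA (by exact_mod_cast hlt) hν hj (by exact_mod_cast hjν)
      exact ⟨by simp [hnot], by simp⟩
    · have hmem := hchoice (π.filter fun i => (A.adv π i ν : EReal) = 0)
        ⟨z, Finset.mem_filter.2 ⟨hz, by rw [hz0]; rfl⟩⟩
      set s := choice (π.filter fun i => (A.adv π i ν : EReal) = 0)
      rw [Finset.mem_filter] at hmem
      refine ih _ _ _ (by rw [Finset.card_erase_of_mem hmem.1]; omega)
        (h.erase hA hle hν hpos ?_ hmem.1 (by exact_mod_cast hmem.2))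
      intro hlt j hj
      by_contra! hc
      exact htest ⟨by exact_mod_cast hlt, j, hj, by exact_mod_cast hc⟩

end Arm

/-! ### Replacing the start at `-∞` by a finite penalty -/

theorem corollary1 {n : ℕ} (A : Arm n) (hA : A.Unichain)
    (choice : Finset (Fin n) → Fin n)
    (hchoice : ∀ s : Finset (Fin n), s.Nonempty → choice s ∈ s) :
    ((∃ index : Fin n → EReal, A.algorithm choice = Arm.Output.indexable index) ↔
      A.Indexable) ∧
    A.algorithm choice ≠ Arm.Output.multichain := by
  obtain ⟨b, hb⟩ := hA.exists_forall_adv_univ_pos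
  have hgreedy : ∀ lam ≤ b, A.Greedy lam Finset.univ := fun lam hlam i =>
    ⟨fun _ => (hb lam hlam i).le, fun h => absurd (Finset.mem_univ i) h⟩
  have hinv : A.LoopInvariant Finset.univ b := by
    refine ⟨hgreedy b le_rfl, fun i _ lam hlam => ?_, fun i hi => absurd (Finset.mem_univ i) hi⟩
    rw [← hA.adv_eq_optAdv (hgreedy lam hlam.le)]
    exact hb lam hlam.le i
  -- No advantage under the full policy vanishes at or below `b`, so the search may start there.
  have hnext : A.nextPenalty Finset.univ ⊥ = A.nextPenalty Finset.univ b := by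
    unfold Arm.nextPenalty
    congr 1
    ext x
    constructor
    · rintro ⟨lam, rfl, -, i, hi, h0⟩
      refine ⟨lam, rfl, ?_, i, hi, h0⟩
      by_contra! hc
      exact (hb lam (by exact_mod_cast hc.le) i).ne' h0
    · rintro ⟨lam, rfl, -, h⟩
      exact ⟨lam, rfl, bot_le, h⟩
  have hstart : A.algorithm choice = A.loop choice n Finset.univ b fun _ => ⊥ := by
    rw [Arm.algorithm, if_neg (not_not.2 (hA _))]
    obtain ⟨m, rfl⟩ := Nat.exists_eq_succ_of_ne_zero hA.neZero.out
    have huni : ∀ ρ, A.UnichainPolicy ρ := hA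
    -- In the first iteration no state is passive, so the test is vacuous and the change of initial
    -- penalty is invisible.
    simp [Arm.loop, hnext, huni]
  rw [hstart]
  exact Arm.LoopInvariant.loop_correct hA hchoice n _ _ _ (by simp) hinv
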